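/- A polytope is a non-empty bounded intersection of finitely many closed half-spaces in some $\mathbb{R}^N$; a $d$-polytope is a polytope whose affine hull has dimension $d$. Its non-empty faces are the sets of maximizers over $P$ of linear functionals (so $P$ itself is a face); vertices, edges and facets are the non-empty faces of dimension $0$, $1$ and $\dim P-1$, respectively. The graph of $P$ has the vertices of $P$ as nodes, two different vertices being adjacent if they lie in a common edge. A path in this graph is non-revisiting if it never returns to a facet of $P$ that it has left, i.e. if for every facet $F$ the nodes of the path lying in $F$ are consecutive. $P$ has the non-revisiting property if any two of its vertices are joined by a non-revisiting path. $P$ is simple if each of its vertices lies in exactly $\dim P$ facets. **Theorem 3.3.** Let $k\ge 0$ be an integer. 1. If every $k$-polytope with exactly $2k$ facets has the non-revisiting property, then, for every $d\ge 0$, every $d$-polytope with exactly $d+k$ facets has the non-revisiting property. 2. The same holds within the class of simple polytopes: if every simple $k$-polytope with exactly $2k$ facets has the non-revisiting property, then, for every $d\ge 0$, every simple $d$-polytope with exactly $d+k$ facets has the non-revisiting property. -/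

import Mathlib

namespace Polytope

section

variable {E : Type*} [NormedAddCommGroup E] [NormedSpace ℝ E]

/-- A polytope: a bounded intersection of finitely many closed half-spaces `a i x ≤ b i`. -/
def IsPolytope (P : Set E) : Prop :=
  Bornology.IsBounded P ∧
    ∃ (m : ℕ) (a : Fin m → StrongDual ℝ E) (b : Fin m → ℝ), P = {x | ∀ i, a i x ≤ b i}

/-- The dimension of the affine hull of a (nonempty) set. -/
noncomputable def dim (P : Set E) : ℕ :=
  Module.finrank ℝ (affineSpan ℝ P).direction

/-- The nonempty faces of `P`: the nonempty sets of maximizers over `P` of a linear functional.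
The zero functional yields the face `P` itself. -/
def IsFace (P F : Set E) : Prop :=
  F.Nonempty ∧ IsExposed ℝ P F

/-- Vertices are the points `x` for which `{x}` is a (zero-dimensional) face. -/
def IsVertex (P : Set E) (x : E) : Prop :=
  IsFace P {x}

/-- Edges are the one-dimensional faces. -/
def IsEdge (P e : Set E) : Prop :=
  IsFace P e ∧ dim e = 1

/-- Facets are the faces of dimension one less than that of `P`. -/
def IsFacet (P F : Set E) : Prop :=
  IsFace P F ∧ dim F + 1 = dim P

/-- The graph (1-skeleton) of `P`: its nodes are the vertices of `P`, and two different vertices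
are adjacent if some edge of `P` contains both. -/
def graph (P : Set E) : SimpleGraph {x : E // IsVertex P x} where
  Adj x y := x ≠ y ∧ ∃ e, IsEdge P e ∧ (x : E) ∈ e ∧ (y : E) ∈ e
  symm := ⟨fun _ _ h => ⟨h.1.symm, h.2.imp fun _ he => ⟨he.1, he.2.2, he.2.1⟩⟩⟩
  loopless := ⟨fun _ h => h.1 rfl⟩

/-- A walk is non-revisiting if it never comes back to a facet that it has left: if its `i`-th and
`l`-th nodes lie in a facet, then so do all the nodes in between. -/
def IsNonRevisiting {P : Set E} {u v : {x : E // IsVertex P x}} (p : (graph P).Walk u v) : Prop :=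
  ∀ F, IsFacet P F → ∀ i j l : ℕ, i ≤ j → j ≤ l → l ≤ p.length →
    (p.getVert i : E) ∈ F → (p.getVert l : E) ∈ F → (p.getVert j : E) ∈ F

/-- Any two vertices of `P` are joined by a non-revisiting path in the graph of `P`. -/
def NonRevisitingProperty (P : Set E) : Prop :=
  ∀ u v : {x : E // IsVertex P x}, ∃ p : (graph P).Walk u v, p.IsPath ∧ IsNonRevisiting p

/-- `P` is a `d`-polytope with exactly `n` facets. -/
def IsPolytopeWithFacets (d n : ℕ) (P : Set E) : Prop :=
  IsPolytope P ∧ P.Nonempty ∧ dim P = d ∧ {F | IsFacet P F}.encard = (n : ℕ∞)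

/-- A polytope is simple if every vertex lies in exactly `dim P` facets. -/
def IsSimple (P : Set E) : Prop :=
  ∀ x, IsVertex P x → {F | IsFacet P F ∧ x ∈ F}.encard = (dim P : ℕ∞)

end

end Polytope

/-! For a `d`-polytope with `n` facets, consider the excess `n - d`. Three facts relate the pairs
(dimension, excess).

Going down: the non-revisiting property passes to facets, because a non-revisiting path between two
vertices of a facet never leaves it. Every polytope is a facet of its prism, which raises dimension
and excess by one each. A polytope with at least one facet is also a facet of a wedge over it, which
raises the dimension and keeps the excess. So `(d + 1, k + 1)` implies `(d, k)`, and `(d + 1, k)`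
implies `(d, k)`.

Going up: a vertex lies in at least `d` facets, so if `n < 2 * d` any two vertices share a facet.
That facet has dimension `d - 1` and excess at most `n - d`, and a non-revisiting path inside it is
non-revisiting in the whole polytope.

Starting from `(k, k)`, prisms give all `(m, m)` with `m ≤ k`; induction on the dimension gives `(d,
m)` for `m ≤ k` and `m ≤ d`; wedges give `(d, k)` for `d < k`. Facets, prisms and wedges of simple
polytopes are simple, so the same argument proves both statements. -/

namespace Polytope

/-! ### Faces described by tight inequalities -/

section Presentations

variable {E : Type*} [NormedAddCommGroup E] [NormedSpace ℝ E]
variable {ι : Type*} {P F G H : Set E} {p q x : E} {L : Submodule ℝ E}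
  {a : ι → StrongDual ℝ E} {b : ι → ℝ} {i : ι}

/-- `P` is the set of points of the flat `p + L` satisfying the inequalities `a i x ≤ b i`, all of
which are strict at `p`. In particular `L` is the direction of the affine hull of `P`. -/
structure IsPresentation (P : Set E) (p : E) (L : Submodule ℝ E) (a : ι → StrongDual ℝ E)
    (b : ι → ℝ) : Prop where
  mem_iff : ∀ x, x ∈ P ↔ x - p ∈ L ∧ ∀ i, a i x ≤ b i
  lt : ∀ i, a i p < b i

/-- Some point of `P` lies on the `i`-th bounding hyperplane and on no other one. -/
def IsIrredundantAt (P : Set E) (a : ι → StrongDual ℝ E) (b : ι → ℝ) (i : ι) : Prop :=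
  ∃ z ∈ P, a i z = b i ∧ ∀ j, j ≠ i → a j z < b j

/-- The points of `P` satisfying with equality all inequalities that are equalities at `q`. -/
def faceAt (P : Set E) (a : ι → StrongDual ℝ E) (b : ι → ℝ) (q : E) : Set E :=
  {x | x ∈ P ∧ ∀ i, a i q = b i → a i x = b i}

/-- The direction of `faceAt P a b q`. -/
def faceDir (L : Submodule ℝ E) (a : ι → StrongDual ℝ E) (b : ι → ℝ) (q : E) : Submodule ℝ E where
  carrier := {v | v ∈ L ∧ ∀ i, a i q = b i → a i v = 0}
  add_mem' := fun hx hy => ⟨L.add_mem hx.1 hy.1, fun i hi => by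
    rw [map_add, hx.2 i hi, hy.2 i hi, add_zero]⟩
  zero_mem' := ⟨L.zero_mem, fun i _ => map_zero _⟩
  smul_mem' := fun c _ hx => ⟨L.smul_mem c hx.1, fun i hi => by
    rw [map_smul, hx.2 i hi, smul_zero]⟩

theorem mem_faceDir {v : E} :
    v ∈ faceDir L a b q ↔ v ∈ L ∧ ∀ i, a i q = b i → a i v = 0 := Iff.rfl

theorem mem_faceAt_self (hq : q ∈ P) : q ∈ faceAt P a b q := ⟨hq, fun _ h => h⟩

theorem faceAt_subset : faceAt P a b q ⊆ P := fun _ h => h.1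

namespace IsPresentation

theorem base_mem (h : IsPresentation P p L a b) : p ∈ P :=
  (h.mem_iff p).2 ⟨by simp, fun i => (h.lt i).le⟩

theorem le (h : IsPresentation P p L a b) (hx : x ∈ P) (i : ι) : a i x ≤ b i :=
  ((h.mem_iff x).1 hx).2 i

theorem sub_mem (h : IsPresentation P p L a b) {y : E} (hx : x ∈ P) (hy : y ∈ P) : x - y ∈ L := by
  have := L.sub_mem ((h.mem_iff x).1 hx).1 ((h.mem_iff y).1 hy).1
  simpa using this

theorem mem_iff' (h : IsPresentation P p L a b) {y : E} (hy : y ∈ P) :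
    x ∈ P ↔ x - y ∈ L ∧ ∀ i, a i x ≤ b i := by
  refine ⟨fun hx => ⟨h.sub_mem hx hy, h.le hx⟩, fun hx => (h.mem_iff x).2 ⟨?_, hx.2⟩⟩
  have := L.add_mem hx.1 (h.sub_mem hy h.base_mem)
  simpa using this

theorem exists_pos_add_smul_mem [Finite ι] (h : IsPresentation P p L a b) {v : E} (hv : v ∈ L) :
    ∃ ε : ℝ, 0 < ε ∧ p + ε • v ∈ P := by
  have key : ∀ᶠ ε : ℝ in nhdsWithin 0 (Set.Ioi 0), ∀ i, a i (p + ε • v) < b i := by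
    rw [Filter.eventually_all]
    intro i
    have hc : Filter.Tendsto (fun ε : ℝ => a i (p + ε • v)) (nhds 0) (nhds (a i p)) := by
      have : Continuous fun ε : ℝ => a i (p + ε • v) := by fun_prop
      simpa using this.tendsto 0
    exact (hc.mono_left nhdsWithin_le_nhds).eventually_lt_const (h.lt i)
  obtain ⟨ε, hε, hpos⟩ := (key.and self_mem_nhdsWithin).exists
  exact ⟨ε, hpos, (h.mem_iff _).2 ⟨by simpa using L.smul_mem ε hv, fun i => (hε i).le⟩⟩

theorem direction_affineSpan [Finite ι] (h : IsPresentation P p L a b) :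
    (affineSpan ℝ P).direction = L := by
  rw [_root_.direction_affineSpan]
  apply le_antisymm
  · rw [vectorSpan_def, Submodule.span_le]
    rintro _ ⟨x, hx, y, hy, rfl⟩
    exact h.sub_mem hx hy
  · intro v hv
    obtain ⟨ε, hε, hmem⟩ := h.exists_pos_add_smul_mem hv
    have := vsub_mem_vectorSpan ℝ hmem h.base_mem
    have h2 := (vectorSpan ℝ P).smul_mem ε⁻¹ this
    simpa [smul_smul, inv_mul_cancel₀ hε.ne'] using h2

theorem dim_eq [Finite ι] (h : IsPresentation P p L a b) : dim P = Module.finrank ℝ L := by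
  rw [dim, h.direction_affineSpan]

theorem mem_faceAt_iff (h : IsPresentation P p L a b) (hq : q ∈ P) :
    x ∈ faceAt P a b q ↔ x ∈ P ∧ x - q ∈ faceDir L a b q := by
  constructor
  · exact fun hx => ⟨hx.1, h.sub_mem hx.1 hq, fun i hi => by rw [map_sub, hx.2 i hi, hi, sub_self]⟩
  · refine fun hx => ⟨hx.1, fun i hi => ?_⟩
    have := hx.2.2 i hi
    rw [map_sub] at this
    linarith

/-- A presentation of a face, in terms of one of its relatively interior points. -/
theorem faceAt (h : IsPresentation P p L a b) (hq : q ∈ P) :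
    IsPresentation (faceAt P a b q) q (faceDir L a b q)
      (fun i : {i // a i q ≠ b i} => a i) (fun i => b i) where
  mem_iff x := by
    rw [h.mem_faceAt_iff hq, h.mem_iff' hq]
    constructor
    · exact fun hx => ⟨hx.2, fun i => hx.1.2 i⟩
    · refine fun hx => ⟨⟨hx.1.1, fun i => ?_⟩, hx.1⟩
      by_cases hi : a i q = b i
      · have := hx.1.2 i hi
        rw [map_sub] at this
        linarith
      · exact hx.2 ⟨i, hi⟩
  lt i := lt_of_le_of_ne (h.le hq i) i.2

/-- The sum of the functionals tight at `q` attains its maximum exactly where each summand does. -/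
theorem isFace_faceAt [Finite ι] (h : IsPresentation P p L a b) (hq : q ∈ P) :
    IsFace P (Polytope.faceAt P a b q) := by
  classical
  cases nonempty_fintype ι
  refine ⟨⟨q, mem_faceAt_self hq⟩, fun _ => ?_⟩
  set J := Finset.univ.filter fun i => a i q = b i
  refine ⟨∑ i ∈ J, a i, ?_⟩
  have hs : ∀ x, (∑ i ∈ J, a i) x = ∑ i ∈ J, a i x := fun x => by simp
  have hle : ∀ x ∈ P, ∑ i ∈ J, a i x ≤ ∑ i ∈ J, b i := fun x hx =>
    Finset.sum_le_sum fun i _ => h.le hx i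
  have hqe : ∑ i ∈ J, a i q = ∑ i ∈ J, b i :=
    Finset.sum_congr rfl fun i hi => (Finset.mem_filter.1 hi).2
  ext x
  constructor
  · refine fun hx => ⟨hx.1, fun y hy => ?_⟩
    rw [hs, hs]
    have : ∑ i ∈ J, a i x = ∑ i ∈ J, b i :=
      Finset.sum_congr rfl fun i hi => hx.2 i (Finset.mem_filter.1 hi).2
    rw [this]
    exact hle y hy
  · refine fun hx => ⟨hx.1, fun i hi => ?_⟩
    have h1 := hx.2 q hq
    rw [hs, hs, hqe] at h1
    have h2 := le_antisymm (hle x hx.1) h1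
    exact (Finset.sum_eq_sum_iff_of_le fun i _ => h.le hx.1 i).1 h2 i (by simp [J, hi])

end IsPresentation

/-- Finitely many inequalities, each of them strict somewhere on a convex set, are simultaneously
strict at some point of it. -/
theorem exists_forall_lt_of_convex {C : Set E} (hC : Convex ℝ C) (hne : C.Nonempty) (s : Finset ι)
    (hle : ∀ i ∈ s, ∀ x ∈ C, a i x ≤ b i) (hlt : ∀ i ∈ s, ∃ x ∈ C, a i x < b i) :
    ∃ x ∈ C, ∀ i ∈ s, a i x < b i := by
  classical
  induction s using Finset.induction_on with
  | empty => exact hne.imp fun x hx => ⟨hx, by simp⟩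
  | insert j s _ ih =>
    obtain ⟨x, hx, hxs⟩ := ih (fun i hi => hle i (Finset.mem_insert_of_mem hi))
      fun i hi => hlt i (Finset.mem_insert_of_mem hi)
    obtain ⟨y, hy, hyj⟩ := hlt j (Finset.mem_insert_self _ _)
    refine ⟨(1 / 2 : ℝ) • x + (1 / 2 : ℝ) • y, hC hx hy (by norm_num) (by norm_num) (by norm_num),
      fun i hi => ?_⟩
    have h1 := hle i hi x hx
    have h2 := hle i hi y hy
    simp only [map_add, map_smul, smul_eq_mul]
    rcases Finset.mem_insert.1 hi with rfl | hi
    · linarith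
    · linarith [hxs i hi]

theorem IsPresentation.convex (h : IsPresentation P p L a b) : Convex ℝ P := by
  intro x hx y hy s t hs ht hst
  rw [h.mem_iff] at hx hy ⊢
  refine ⟨?_, fun i => ?_⟩
  · have : s • x + t • y - p = s • (x - p) + t • (y - p) := by
      rw [smul_sub, smul_sub, sub_add_sub_comm, ← add_smul, hst, one_smul]
    rw [this]
    exact L.add_mem (L.smul_mem s hx.1) (L.smul_mem t hy.1)
  · simp only [map_add, map_smul, smul_eq_mul]
    have h1 := mul_le_mul_of_nonneg_left (hx.2 i) hs
    have h2 := mul_le_mul_of_nonneg_left (hy.2 i) ht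
    have h3 : s * b i + t * b i = b i := by rw [← add_mul, hst, one_mul]
    linarith

theorem IsFace.subset (hF : IsFace P F) : F ⊆ P := by
  obtain ⟨l, hl⟩ := hF.2 hF.1
  rw [hl]
  exact fun x hx => hx.1

theorem IsFace.inter (hF : IsFace P F) (hG : IsFace P G) (hne : (F ∩ G).Nonempty) :
    IsFace G (F ∩ G) := by
  obtain ⟨l, hl⟩ := hF.2 hF.1
  refine ⟨hne, fun _ => ⟨l, ?_⟩⟩
  obtain ⟨w, hwF, hwG⟩ := hne
  ext x
  constructor
  · rintro ⟨hx, hxG⟩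
    rw [hl] at hx
    exact ⟨hxG, fun y hy => hx.2 y (hG.subset hy)⟩
  · rintro ⟨hxG, hx⟩
    refine ⟨?_, hxG⟩
    rw [hl] at hwF ⊢
    exact ⟨hG.subset hxG, fun y hy => (hwF.2 y hy).trans (hx w hwG)⟩

theorem IsFace.of_subset (hF : IsFace P F) (hG : IsFace P G) (hFG : F ⊆ G) : IsFace G F := by
  have := hF.inter hG (by rw [Set.inter_eq_left.2 hFG]; exact hF.1)
  rwa [Set.inter_eq_left.2 hFG] at this

namespace IsPresentation

/-- A relatively interior `q` works: every inequality that is strict somewhere on `F` is strict at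
`q`. -/
theorem exists_eq_faceAt [Finite ι] (h : IsPresentation P p L a b) (hF : IsFace P F) :
    ∃ q ∈ F, F = Polytope.faceAt P a b q := by
  classical
  cases nonempty_fintype ι
  obtain ⟨l, hl⟩ := hF.2 hF.1
  have hconv : Convex ℝ F := (hF.2.convex h.convex)
  obtain ⟨q, hq, hlt⟩ := exists_forall_lt_of_convex (a := a) (b := b) hconv hF.1
    (Finset.univ.filter fun i => ∃ x ∈ F, a i x < b i)
    (fun i _ x hx => h.le (hF.subset hx) i) (fun i hi => (Finset.mem_filter.1 hi).2)
  refine ⟨q, hq, ?_⟩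
  have hqP := hF.subset hq
  ext x
  constructor
  · refine fun hx => ⟨hF.subset hx, fun i hi => ?_⟩
    by_contra hne
    exact (hlt i (by simpa using ⟨x, hx, lt_of_le_of_ne (h.le (hF.subset hx) i) hne⟩)).ne hi
  · intro hx
    have hv := ((h.mem_faceAt_iff hqP).1 hx).2
    -- The segment from `x` to `q` can be prolonged beyond `q` within `P`. As `l` is maximal at `q`,
    -- its value at `x` cannot be smaller.
    obtain ⟨ε, hε, hmem⟩ := (h.faceAt hqP).exists_pos_add_smul_mem
      ((faceDir L a b q).neg_mem hv)
    rw [hl] at hq ⊢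
    refine ⟨hx.1, fun y hy => (hq.2 y hy).trans ?_⟩
    have h1 := hq.2 _ hmem.1
    simp only [map_add, map_smul, map_neg, map_sub, smul_eq_mul] at h1
    nlinarith

theorem dim_faceAt [Finite ι] (h : IsPresentation P p L a b) (hq : q ∈ P) :
    dim (Polytope.faceAt P a b q) = Module.finrank ℝ (faceDir L a b q) :=
  (h.faceAt hq).dim_eq

/-- The faces of a face are faces. -/
theorem isFace_trans [Finite ι] (h : IsPresentation P p L a b) (hF : IsFace P F)
    (hG : IsFace F G) : IsFace P G := by
  obtain ⟨q, hq, rfl⟩ := h.exists_eq_faceAt hF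
  obtain ⟨r, hr, rfl⟩ := (h.faceAt hq.1).exists_eq_faceAt hG
  have hrF := hG.subset hr
  convert h.isFace_faceAt hrF.1 using 1
  ext x
  constructor
  · rintro ⟨hx, hxr⟩
    refine ⟨hx.1, fun i hi => ?_⟩
    by_cases hiq : a i q = b i
    · exact hx.2 i hiq
    · exact hxr ⟨i, hiq⟩ hi
  · rintro ⟨hx, hxr⟩
    exact ⟨⟨hx, fun i hi => hxr i (hrF.2 i hi)⟩, fun i hi => hxr i hi⟩

end IsPresentation

section FiniteDimensional

variable [FiniteDimensional ℝ E]

theorem dim_mono (h : F ⊆ G) : dim F ≤ dim G :=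
  Submodule.finrank_mono (AffineSubspace.direction_le (affineSpan_mono ℝ h))

namespace IsPresentation

theorem eq_of_isFace_of_dim_le [Finite ι] (h : IsPresentation P p L a b) (hF : IsFace P F)
    (hd : dim P ≤ dim F) : F = P := by
  obtain ⟨q, hq, rfl⟩ := h.exists_eq_faceAt hF
  rw [h.dim_eq, h.dim_faceAt hq.1] at hd
  have hle : faceDir L a b q ≤ L := fun v hv => hv.1
  have heq := Submodule.eq_of_le_of_finrank_le hle hd
  apply faceAt_subset.antisymm
  intro x hx
  rw [h.mem_faceAt_iff hq.1, heq]
  exact ⟨hx, h.sub_mem hx hq.1⟩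

theorem isVertex_iff [Finite ι] (h : IsPresentation P p L a b) :
    IsVertex P x ↔ x ∈ P ∧ ∀ v ∈ L, (∀ i, a i x = b i → a i v = 0) → v = 0 := by
  constructor
  · intro hx
    obtain ⟨q, hq, heq⟩ := h.exists_eq_faceAt hx
    obtain rfl := Set.mem_singleton_iff.1 hq
    have hqP := hx.subset hq
    have hd := h.dim_faceAt hqP
    rw [← heq] at hd
    have h0 : dim {q} = 0 := by simp [dim, _root_.direction_affineSpan]
    rw [h0, eq_comm, Submodule.finrank_eq_zero] at hd
    refine ⟨hqP, fun v hv hv0 => ?_⟩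
    have : v ∈ faceDir L a b q := ⟨hv, hv0⟩
    rw [hd] at this
    simpa using this
  · rintro ⟨hx, hv⟩
    have : Polytope.faceAt P a b x = {x} := by
      ext y
      rw [Set.mem_singleton_iff]
      constructor
      · intro hy
        have := ((h.mem_faceAt_iff hx).1 hy).2
        exact sub_eq_zero.1 (hv _ this.1 this.2)
      · rintro rfl
        exact mem_faceAt_self hx
    rw [IsVertex, ← this]
    exact h.isFace_faceAt hx

/-- At a vertex the tight functionals have no common zero in `L` but `0`, so together they embed
`L`. -/
theorem finrank_le_ncard [Finite ι] (h : IsPresentation P p L a b) (hx : IsVertex P x) :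
    Module.finrank ℝ L ≤ {i | a i x = b i}.ncard := by
  classical
  cases nonempty_fintype ι
  let f : L →ₗ[ℝ] ({i | a i x = b i} → ℝ) :=
    LinearMap.pi fun i => (a i : E →ₗ[ℝ] ℝ).comp L.subtype
  have hf : Function.Injective f := by
    rw [← LinearMap.ker_eq_bot, LinearMap.ker_eq_bot']
    intro v hv
    have := (h.isVertex_iff.1 hx).2 v v.2 fun i hi => congrFun hv ⟨i, hi⟩
    exact_mod_cast this
  have := LinearMap.finrank_le_finrank_of_injective hf
  rwa [Module.finrank_fintype_fun_eq_card, ← Nat.card_eq_fintype_card,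
    Nat.card_coe_set_eq] at this

end IsPresentation

end FiniteDimensional

end Presentations

end Polytope

namespace Polytope

/-! ### Irredundant presentations and facets -/

section Facets

variable {E : Type*} [NormedAddCommGroup E] [NormedSpace ℝ E]
variable {ι : Type*} {P F G H : Set E} {p q x : E} {L : Submodule ℝ E}
  {a : ι → StrongDual ℝ E} {b : ι → ℝ} {i : ι}

/-- The segment from `p` to `y` crosses the `i`-th hyperplane before `y`; the other inequalities,
strict at `p`, are still strict there. -/
theorem IsPresentation.isIrredundantAt_of_lt (h : IsPresentation P p L a b) {y : E}
    (hyL : y - p ∈ L) (hyi : b i < a i y) (hy : ∀ j, j ≠ i → a j y ≤ b j) :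
    IsIrredundantAt P a b i := by
  have hp := h.lt i
  have hpos : 0 < a i y - a i p := by linarith
  set θ : ℝ := (b i - a i p) / (a i y - a i p) with hθ
  have hθ0 : 0 < θ := div_pos (by linarith) hpos
  have hθ1 : θ < 1 := (div_lt_one hpos).2 (by linarith)
  have hmul : θ * (a i y - a i p) = b i - a i p := div_mul_cancel₀ _ hpos.ne'
  have hval : ∀ j, a j (p + θ • (y - p)) = a j p + θ * (a j y - a j p) := fun j => by simp
  have hi : a i (p + θ • (y - p)) = b i := by rw [hval, hmul]; ring
  have hj : ∀ j, j ≠ i → a j (p + θ • (y - p)) < b j := fun j hji => by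
    rw [hval]
    have h1 := h.lt j
    have h2 := hy j hji
    have h3 : θ * (a j y - a j p) ≤ θ * (b j - a j p) :=
      mul_le_mul_of_nonneg_left (by linarith) hθ0.le
    nlinarith
  refine ⟨_, (h.mem_iff _).2 ⟨by simpa using L.smul_mem θ hyL, fun j => ?_⟩, hi, hj⟩
  rcases eq_or_ne j i with rfl | hji
  · exact hi.le
  · exact (hj j hji).le

/-- Every non-empty polytope has an irredundant presentation. -/
theorem IsPolytope.exists_presentation (hP : IsPolytope P) (hne : P.Nonempty) :
    ∃ (m : ℕ) (s : Finset (Fin m)) (p : E) (L : Submodule ℝ E) (a : s → StrongDual ℝ E)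
      (b : s → ℝ), IsPresentation P p L a b ∧ ∀ i, IsIrredundantAt P a b i := by
  classical
  obtain ⟨-, m, a, b, hP⟩ := hP
  have hle : ∀ x ∈ P, ∀ i, a i x ≤ b i := fun x hx => by rw [hP] at hx; exact hx
  have hconv : Convex ℝ P := by
    rw [hP]
    simp only [Set.ofPred_forall]
    exact convex_iInter fun i => convex_halfSpace_le (a i).toLinearMap.isLinear _
  -- The inequalities outside `s₀` are equalities on all of `P`; they are absorbed into the flat `p
  -- + L`.
  set s₀ : Finset (Fin m) := Finset.univ.filter fun i => ∃ x ∈ P, a i x < b i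
  obtain ⟨p, hp, hlt⟩ := exists_forall_lt_of_convex hconv hne s₀
    (fun i _ x hx => hle x hx i) (fun i hi => (Finset.mem_filter.1 hi).2)
  have hs₀ : ∀ i, i ∉ s₀ → ∀ x ∈ P, a i x = b i := fun i hi x hx => by
    by_contra hne
    exact hi (by simpa [s₀] using ⟨x, hx, lt_of_le_of_ne (hle x hx i) hne⟩)
  let L : Submodule ℝ E := ⨅ i : {i // i ∉ s₀}, LinearMap.ker (a i).toLinearMap
  have hL : ∀ v, v ∈ L ↔ ∀ i, i ∉ s₀ → a i v = 0 := fun v => by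
    simp [L, Submodule.mem_iInf]
  let Q : Finset (Fin m) → Prop := fun s =>
    s ⊆ s₀ ∧ ∀ x, x - p ∈ L → (∀ i ∈ s, a i x ≤ b i) → x ∈ P
  have hQ₀ : Q s₀ := by
    refine ⟨subset_rfl, fun x hx hxs => ?_⟩
    rw [hP]
    intro i
    by_cases hi : i ∈ s₀
    · exact hxs i hi
    · have h1 := (hL _).1 hx i hi
      rw [map_sub, hs₀ i hi p hp] at h1
      linarith
  -- By minimality, dropping any `i ∈ s` admits a point outside `P`, which can violate only the
  -- `i`-th inequality.
  obtain ⟨s, hs⟩ := exists_minimal_of_wellFoundedLT Q ⟨s₀, hQ₀⟩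
  have hpres : IsPresentation P p L (fun i : s => a i) (fun i => b i) := by
    refine ⟨fun x => ⟨fun hx => ⟨?_, fun i => hle x hx i⟩, fun hx => ?_⟩, fun i => ?_⟩
    · rw [hL]
      intro i hi
      rw [map_sub, hs₀ i hi x hx, hs₀ i hi p hp, sub_self]
    · exact hs.prop.2 x hx.1 fun i hi => hx.2 ⟨i, hi⟩
    · exact hlt i (hs.prop.1 i.2)
  refine ⟨m, s, p, L, fun i => a i, fun i => b i, hpres, fun i => ?_⟩
  have hnot : ¬ Q (s.erase i) := fun hQ =>
    Finset.notMem_erase (i : Fin m) s (hs.le_of_le hQ (Finset.erase_subset _ _) i.2)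
  have hex : ∃ x, x - p ∈ L ∧ (∀ j ∈ s.erase i, a j x ≤ b j) ∧ x ∉ P := by
    by_contra hcon
    push Not at hcon
    exact hnot ⟨(Finset.erase_subset _ _).trans hs.prop.1, hcon⟩
  obtain ⟨y, hyL, hy, hyP⟩ := hex
  have hyj : ∀ j : s, j ≠ i → a j y ≤ b j := fun j hj =>
    hy j (Finset.mem_erase.2 ⟨fun h => hj (Subtype.ext h), j.2⟩)
  refine hpres.isIrredundantAt_of_lt hyL ?_ hyj
  by_contra hcon
  refine hyP ((hpres.mem_iff y).2 ⟨hyL, fun j => ?_⟩)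
  rcases eq_or_ne j i with rfl | hji
  · exact not_lt.1 hcon
  · exact hyj j hji

/-- The points of `P` on the `i`-th bounding hyperplane. -/
def wall (P : Set E) (a : ι → StrongDual ℝ E) (b : ι → ℝ) (i : ι) : Set E :=
  {x | x ∈ P ∧ a i x = b i}

theorem faceAt_eq_wall {z : E} (hz : a i z = b i) (hz' : ∀ j, j ≠ i → a j z < b j) :
    faceAt P a b z = wall P a b i := by
  ext x
  refine ⟨fun hx => ⟨hx.1, hx.2 i hz⟩, fun hx => ⟨hx.1, fun j hj => ?_⟩⟩
  rcases eq_or_ne j i with rfl | hji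
  · exact hx.2
  · exact absurd hj (hz' j hji).ne

theorem wall_injective (hirr : ∀ i, IsIrredundantAt P a b i) :
    Function.Injective (wall P a b) := by
  intro i j hij
  obtain ⟨z, hz, hzi, hzj⟩ := hirr i
  by_contra hne
  have : z ∈ wall P a b j := hij ▸ ⟨hz, hzi⟩
  exact (hzj j (Ne.symm hne)).ne this.2

theorem IsPolytope.inter_halfSpace (hP : IsPolytope P) (l : StrongDual ℝ E) (c : ℝ) :
    IsPolytope (P ∩ {x | l x ≤ c}) := by
  obtain ⟨hbd, m, a, b, hP⟩ := hP
  refine ⟨hbd.subset Set.inter_subset_left, m + 1, Fin.cons l a, Fin.cons c b, ?_⟩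
  ext x
  simp [hP, Fin.forall_fin_succ, and_comm]

theorem IsFace.isPolytope (hF : IsFace P F) (hP : IsPolytope P) : IsPolytope F := by
  obtain ⟨l, hl⟩ := hF.2 hF.1
  obtain ⟨w, hw⟩ := hF.1
  convert hP.inter_halfSpace (-l) (-(l w)) using 1
  ext x
  simp only [Set.mem_inter_iff, Set.mem_ofPred_eq, neg_apply, neg_le_neg_iff]
  constructor
  · intro hx
    exact ⟨hF.subset hx, by rw [hl] at hx; exact hx.2 w (hF.subset hw)⟩
  · rintro ⟨hx, hxw⟩
    rw [hl] at hw ⊢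
    exact ⟨hx, fun y hy => (hw.2 y hy).trans hxw⟩

theorem IsPolytope.isFace_trans (hP : IsPolytope P) (hF : IsFace P F) (hG : IsFace F G) :
    IsFace P G := by
  obtain ⟨m, s, p, L, a, b, h, -⟩ := hP.exists_presentation (hF.1.mono hF.subset)
  exact h.isFace_trans hF hG

theorem IsPolytope.eq_of_isFace_of_dim_le [FiniteDimensional ℝ E] (hP : IsPolytope P)
    (hF : IsFace P F) (hd : dim P ≤ dim F) : F = P := by
  obtain ⟨m, s, p, L, a, b, h, -⟩ := hP.exists_presentation (hF.1.mono hF.subset)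
  exact h.eq_of_isFace_of_dim_le hF hd

namespace IsPresentation

theorem finrank_ker_add_one [FiniteDimensional ℝ E] {l : StrongDual ℝ E} {M : Submodule ℝ E}
    (hM : ∀ v, v ∈ M ↔ v ∈ L ∧ l v = 0) (hl : ∃ v ∈ L, l v ≠ 0) :
    Module.finrank ℝ M + 1 = Module.finrank ℝ L := by
  obtain ⟨v, hv, hlv⟩ := hl
  let f : Module.Dual ℝ L := (l : E →ₗ[ℝ] ℝ).comp L.subtype
  have hf : f ≠ 0 := fun h0 => hlv (LinearMap.congr_fun h0 ⟨v, hv⟩)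
  have hmap : (LinearMap.ker f).map L.subtype = M := by
    ext w
    rw [hM, Submodule.mem_map]
    constructor
    · rintro ⟨u, hu, rfl⟩
      exact ⟨u.2, hu⟩
    · exact fun hw => ⟨⟨w, hw.1⟩, hw.2, rfl⟩
  rw [← hmap, Submodule.finrank_map_subtype_eq]
  exact Module.Dual.finrank_ker_add_one_of_ne_zero hf

variable [FiniteDimensional ℝ E] [Finite ι]

theorem isFacet_wall (h : IsPresentation P p L a b) (hi : IsIrredundantAt P a b i) :
    IsFacet P (wall P a b i) := by
  obtain ⟨z, hz, hzi, hzj⟩ := hi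
  rw [← faceAt_eq_wall hzi hzj]
  refine ⟨h.isFace_faceAt hz, ?_⟩
  rw [h.dim_eq, h.dim_faceAt hz]
  refine finrank_ker_add_one (l := a i) (fun v => ?_) ⟨z - p, h.sub_mem hz h.base_mem, ?_⟩
  · rw [mem_faceDir]
    refine and_congr_right fun _ => ⟨fun hv => hv i hzi, fun hv j hj => ?_⟩
    rcases eq_or_ne j i with rfl | hji
    · exact hv
    · exact absurd hj (hzj j hji).ne
  · have := h.lt i
    rw [map_sub, hzi]
    linarith

/-- A facet is a proper face, so some inequality is tight on it. It then lies in a wall of the same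
dimension, hence equals it. -/
theorem isFacet_iff (h : IsPresentation P p L a b) (hP : IsPolytope P)
    (hirr : ∀ i, IsIrredundantAt P a b i) : IsFacet P F ↔ ∃ i, F = wall P a b i := by
  constructor
  · intro hF
    obtain ⟨q, hq, hFq⟩ := h.exists_eq_faceAt hF.1
    have hqP := hF.1.subset hq
    have : ∃ i, a i q = b i := by
      by_contra hcon
      push Not at hcon
      have : F = P := by
        rw [hFq]
        ext x
        exact ⟨fun hx => hx.1, fun hx => ⟨hx, fun i hi => absurd hi (hcon i)⟩⟩
      have hd := hF.2
      rw [this] at hd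
      omega
    obtain ⟨i, hi⟩ := this
    refine ⟨i, ?_⟩
    have hw := h.isFacet_wall (hirr i)
    have hsub : F ⊆ wall P a b i := by
      rw [hFq]
      exact fun x hx => ⟨hx.1, hx.2 i hi⟩
    refine (hw.1.isPolytope hP).eq_of_isFace_of_dim_le (hF.1.of_subset hw.1 hsub) ?_
    have h1 := hF.2
    have h2 := hw.2
    omega
  · rintro ⟨i, rfl⟩
    exact h.isFacet_wall (hirr i)

theorem encard_facets_mem (h : IsPresentation P p L a b) (hP : IsPolytope P)
    (hirr : ∀ i, IsIrredundantAt P a b i) (hx : x ∈ P) :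
    {F | IsFacet P F ∧ x ∈ F}.encard = ({i | a i x = b i}.ncard : ℕ∞) := by
  have : {F | IsFacet P F ∧ x ∈ F} = wall P a b '' {i | a i x = b i} := by
    ext F
    simp only [Set.mem_ofPred_eq, Set.mem_image, h.isFacet_iff hP hirr]
    constructor
    · rintro ⟨⟨i, rfl⟩, hxi⟩
      exact ⟨i, hxi.2, rfl⟩
    · rintro ⟨i, hi, rfl⟩
      exact ⟨⟨i, rfl⟩, hx, hi⟩
  rw [this, (wall_injective hirr).encard_image, ← (Set.toFinite _).cast_ncard_eq]

theorem encard_facets (h : IsPresentation P p L a b) (hP : IsPolytope P)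
    (hirr : ∀ i, IsIrredundantAt P a b i) : {F | IsFacet P F}.encard = (Nat.card ι : ℕ∞) := by
  have : {F | IsFacet P F} = Set.range (wall P a b) := by
    ext F
    simp only [Set.mem_ofPred_eq, Set.mem_range, h.isFacet_iff hP hirr, eq_comm]
  rw [this, ← Set.image_univ, (wall_injective hirr).encard_image, ← Set.ncard_univ,
    (Set.toFinite _).cast_ncard_eq]

/-- A facet of a facet is the intersection with another facet. -/
theorem exists_wall_of_isFacet_wall (h : IsPresentation P p L a b) (hP : IsPolytope P)
    (hirr : ∀ i, IsIrredundantAt P a b i) (hH : IsFacet (wall P a b i) H) :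
    ∃ j, j ≠ i ∧ H = wall P a b j ∩ wall P a b i := by
  have hw := h.isFacet_wall (hirr i)
  have hwP := hw.1.isPolytope hP
  obtain ⟨q, hq, hHq⟩ := h.exists_eq_faceAt (h.isFace_trans hw.1 hH.1)
  have hqw := hH.1.subset hq
  have : ∃ j, j ≠ i ∧ a j q = b j := by
    by_contra hcon
    push Not at hcon
    have heq : H = wall P a b i := by
      rw [hHq]
      exact faceAt_eq_wall hqw.2 fun j hj => lt_of_le_of_ne (h.le hqw.1 j) (hcon j hj)
    have hd := hH.2
    rw [heq] at hd
    omega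
  obtain ⟨j, hji, hj⟩ := this
  refine ⟨j, hji, ?_⟩
  have hK : IsFace (wall P a b i) (wall P a b j ∩ wall P a b i) :=
    (h.isFacet_wall (hirr j)).1.inter hw.1 ⟨q, ⟨hqw.1, hj⟩, hqw⟩
  have hHK : H ⊆ wall P a b j ∩ wall P a b i := by
    refine Set.subset_inter ?_ hH.1.subset
    rw [hHq]
    exact fun x hx => ⟨hx.1, hx.2 j hj⟩
  -- Irredundancy makes the intersection a proper face of the wall, leaving no dimension between it
  -- and the facet `H`.
  have hlt : dim (wall P a b j ∩ wall P a b i) < dim (wall P a b i) := by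
    by_contra hcon
    have heq := hwP.eq_of_isFace_of_dim_le hK (not_lt.1 hcon)
    obtain ⟨z, hz, hzi, hzj⟩ := hirr i
    have hzw : z ∈ wall P a b i := ⟨hz, hzi⟩
    rw [← heq] at hzw
    exact (hzj j hji).ne hzw.1.2
  refine (hK.isPolytope hwP).eq_of_isFace_of_dim_le (hH.1.of_subset hK hHK) ?_
  have := hH.2
  omega

end IsPresentation

end Facets

end Polytope

namespace Polytope

/-! ### Non-revisiting paths in a polytope and in its facets -/

section Paths

variable {E : Type*} [NormedAddCommGroup E] [NormedSpace ℝ E]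
variable {P F G H : Set E} {u v x : E} {n : ℕ} {f : ℕ → E}

/-- The points `f 0, …, f n` are the nodes of a non-revisiting path in the graph of `P`. -/
structure IsNonRevisitingSeq (P : Set E) (n : ℕ) (f : ℕ → E) : Prop where
  isVertex : ∀ i ≤ n, IsVertex P (f i)
  exists_edge : ∀ i < n, ∃ e, IsEdge P e ∧ f i ∈ e ∧ f (i + 1) ∈ e
  injOn : Set.InjOn f {i | i ≤ n}
  mem_facet : ∀ F, IsFacet P F → ∀ i j l : ℕ, i ≤ j → j ≤ l → l ≤ n → f i ∈ F → f l ∈ F → f j ∈ F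

theorem _root_.SimpleGraph.exists_walk_getVert_eq {V : Type*} (G : SimpleGraph V) (n : ℕ)
    (f : ℕ → V) (hf : ∀ i < n, G.Adj (f i) (f (i + 1))) :
    ∃ p : G.Walk (f 0) (f n), p.length = n ∧ ∀ i ≤ n, p.getVert i = f i := by
  induction n generalizing f with
  | zero => exact ⟨.nil, rfl, fun i hi => by simp [Nat.le_zero.1 hi]⟩
  | succ n ih =>
    obtain ⟨p, hp, hpf⟩ := ih (fun i => f (i + 1)) fun i hi => hf (i + 1) (by omega)
    refine ⟨.cons (hf 0 (by omega)) p, by simp [hp], fun i hi => ?_⟩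
    cases i with
    | zero => simp
    | succ i => simpa using hpf i (by omega)

/-- Sequences of points, unlike walks, do not depend on `P` in their type and can be shared by a
polytope and its facets. -/
theorem nonRevisitingProperty_iff :
    NonRevisitingProperty P ↔ ∀ u v, IsVertex P u → IsVertex P v →
      ∃ (n : ℕ) (f : ℕ → E), f 0 = u ∧ f n = v ∧ IsNonRevisitingSeq P n f := by
  constructor
  · intro h u v hu hv
    obtain ⟨p, hp, hnr⟩ := h ⟨u, hu⟩ ⟨v, hv⟩
    refine ⟨p.length, fun i => p.getVert i, by simp, by simp, fun i _ => (p.getVert i).2,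
      fun i hi => (p.adj_getVert_succ hi).2, fun i hi j hj hij => ?_, hnr⟩
    exact hp.getVert_injOn hi hj (Subtype.ext hij)
  · rintro h ⟨u, hu⟩ ⟨v, hv⟩
    obtain ⟨n, f, rfl, rfl, hf⟩ := h u v hu hv
    let g : ℕ → {x : E // IsVertex P x} := fun i => ⟨f (min i n), hf.isVertex _ (min_le_right _ _)⟩
    have hg : ∀ i ≤ n, (g i : E) = f i := fun i hi => by simp only [g, min_eq_left hi]
    obtain ⟨p, hp, hpg⟩ := (graph P).exists_walk_getVert_eq n g fun i hi => by
      refine ⟨fun hne => ?_, ?_⟩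
      · have := congrArg Subtype.val hne
        rw [hg i hi.le, hg (i + 1) hi] at this
        have := hf.injOn hi.le (Nat.succ_le_of_lt hi) this
        omega
      · rw [hg i hi.le, hg (i + 1) hi]
        exact hf.exists_edge i hi
    have h0 : g 0 = ⟨f 0, hu⟩ := Subtype.ext (hg 0 (Nat.zero_le _))
    have hn : g n = ⟨f n, hv⟩ := Subtype.ext (hg n le_rfl)
    have hval : ∀ i ≤ n, ((p.copy h0 hn).getVert i : E) = f i := fun i hi => by
      rw [SimpleGraph.Walk.getVert_copy, hpg i hi, hg i hi]
    refine ⟨p.copy h0 hn, ?_, fun F hF i j l hij hjl hl hi hl' => ?_⟩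
    · rw [← SimpleGraph.Walk.IsPath.getVert_injOn_iff]
      intro i hi j hj hij
      simp only [Set.mem_ofPred_eq, SimpleGraph.Walk.length_copy, hp] at hi hj
      have := congrArg Subtype.val hij
      rw [hval i hi, hval j hj] at this
      exact hf.injOn hi hj this
    · rw [SimpleGraph.Walk.length_copy, hp] at hl
      rw [hval i (by omega)] at hi
      rw [hval l hl] at hl'
      rw [hval j (by omega)]
      exact hf.mem_facet F hF i j l hij hjl hl hi hl'

theorem dim_pos_of_nontrivial [FiniteDimensional ℝ E] (hF : F.Nontrivial) : 0 < dim F := by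
  obtain ⟨x, hx, y, hy, hne⟩ := hF
  rw [dim, Module.finrank_pos_iff, Submodule.nontrivial_iff_ne_bot]
  intro h
  have := AffineSubspace.vsub_mem_direction (subset_affineSpan ℝ F hx) (subset_affineSpan ℝ F hy)
  rw [h, Submodule.mem_bot, vsub_eq_sub, sub_eq_zero] at this
  exact hne this

variable [FiniteDimensional ℝ E]

/-- A facet of a facet is the intersection with another facet. -/
theorem IsPolytope.exists_isFacet_inter (hP : IsPolytope P) (hF : IsFacet P F)
    (hH : IsFacet F H) : ∃ G, IsFacet P G ∧ G ≠ F ∧ H = G ∩ F := by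
  obtain ⟨m, s, p, L, a, b, h, hirr⟩ := hP.exists_presentation (hF.1.1.mono hF.1.subset)
  obtain ⟨i, rfl⟩ := (h.isFacet_iff hP hirr).1 hF
  obtain ⟨j, hji, rfl⟩ := h.exists_wall_of_isFacet_wall hP hirr hH
  exact ⟨_, h.isFacet_wall (hirr j), fun heq => hji (wall_injective hirr heq), rfl⟩

/-- The facets of a polytope with the non-revisiting property have it as well. -/
theorem NonRevisitingProperty.of_isFacet (h : NonRevisitingProperty P) (hP : IsPolytope P)
    (hF : IsFacet P F) : NonRevisitingProperty F := by
  rw [nonRevisitingProperty_iff] at h ⊢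
  intro u v hu hv
  obtain ⟨n, f, rfl, rfl, hf⟩ := h u v (hP.isFace_trans hF.1 hu) (hP.isFace_trans hF.1 hv)
  have hmem : ∀ i ≤ n, f i ∈ F := fun i hi =>
    hf.mem_facet F hF 0 i n (Nat.zero_le _) hi le_rfl (hu.subset rfl) (hv.subset rfl)
  refine ⟨n, f, rfl, rfl, fun i hi => ?_, fun i hi => ?_, hf.injOn,
    fun H hH i j l hij hjl hl hi hl' => ?_⟩
  · exact (hf.isVertex i hi).of_subset hF.1 (Set.singleton_subset_iff.2 (hmem i hi))
  · obtain ⟨e, he, hei, hei'⟩ := hf.exists_edge i hi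
    have hi₁ : f i ∈ e ∩ F := ⟨hei, hmem i hi.le⟩
    have hi₂ : f (i + 1) ∈ e ∩ F := ⟨hei', hmem (i + 1) hi⟩
    refine ⟨e ∩ F, ⟨he.1.inter hF.1 ⟨_, hi₁⟩, ?_⟩, hi₁, hi₂⟩
    have hne : f i ≠ f (i + 1) := fun hne => by
      have := hf.injOn hi.le (Nat.succ_le_of_lt hi) hne
      omega
    have h1 := dim_pos_of_nontrivial ⟨_, hi₁, _, hi₂, hne⟩
    have h2 := dim_mono (F := e ∩ F) (G := e) Set.inter_subset_left
    rw [he.2] at h2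
    omega
  · obtain ⟨G, hG, -, rfl⟩ := hP.exists_isFacet_inter hF hH
    exact ⟨hf.mem_facet G hG i j l hij hjl hl hi.1 hl'.1, hmem j (by omega)⟩

/-- A non-revisiting path within a facet is non-revisiting in the whole polytope. -/
theorem IsNonRevisitingSeq.of_isFacet (hP : IsPolytope P) (hF : IsFacet P F)
    (hf : IsNonRevisitingSeq F n f) : IsNonRevisitingSeq P n f := by
  refine ⟨fun i hi => hP.isFace_trans hF.1 (hf.isVertex i hi), fun i hi => ?_, hf.injOn,
    fun G hG i j l hij hjl hl hi hl' => ?_⟩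
  · obtain ⟨e, he, hei⟩ := hf.exists_edge i hi
    exact ⟨e, ⟨hP.isFace_trans hF.1 he.1, he.2⟩, hei⟩
  -- `G ∩ F` is a face of `F`, hence cut out by walls of `F`, and the path revisits none of these.
  · have hFP := hF.1.isPolytope hP
    obtain ⟨m, s, p, L, a, b, hpres, hirr⟩ := hFP.exists_presentation hF.1.1
    have hmem : ∀ i ≤ n, f i ∈ F := fun i hi => (hf.isVertex i hi).subset rfl
    have hGF := hG.1.inter hF.1 ⟨f i, hi, hmem i (by omega)⟩
    obtain ⟨q, hq, hGq⟩ := hpres.exists_eq_faceAt hGF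
    have hfi : f i ∈ G ∩ F := ⟨hi, hmem i (by omega)⟩
    have hfl : f l ∈ G ∩ F := ⟨hl', hmem l hl⟩
    suffices f j ∈ G ∩ F from this.1
    rw [hGq] at hfi hfl ⊢
    refine ⟨hmem j (by omega), fun k hk => ?_⟩
    exact (hf.mem_facet _ (hpres.isFacet_wall (hirr k)) i j l hij hjl hl
      ⟨hfi.1, hfi.2 k hk⟩ ⟨hfl.1, hfl.2 k hk⟩).2

end Paths

/-! ### Counting facets -/

section FacetCounts

variable {E : Type*} [NormedAddCommGroup E] [NormedSpace ℝ E] [FiniteDimensional ℝ E]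
variable {P F : Set E} {u v x : E} {d n : ℕ}

theorem IsPolytope.dim_le_encard_facets_mem (hP : IsPolytope P) (hx : IsVertex P x) :
    (dim P : ℕ∞) ≤ {F | IsFacet P F ∧ x ∈ F}.encard := by
  have hxP := hx.subset rfl
  obtain ⟨m, s, p, L, a, b, h, hirr⟩ := hP.exists_presentation ⟨x, hxP⟩
  rw [h.encard_facets_mem hP hirr hxP, h.dim_eq]
  exact_mod_cast h.finrank_le_ncard hx

/-- Two vertices of a polytope with few facets share a facet. -/
theorem exists_isFacet_of_lt_two_mul (hP : IsPolytopeWithFacets d n P) (hn : n < 2 * d)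
    (hu : IsVertex P u) (hv : IsVertex P v) : ∃ F, IsFacet P F ∧ u ∈ F ∧ v ∈ F := by
  obtain ⟨hpol, -, hd, hcard⟩ := hP
  by_contra hcon
  push Not at hcon
  have hdisj : Disjoint {F | IsFacet P F ∧ u ∈ F} {F | IsFacet P F ∧ v ∈ F} :=
    Set.disjoint_left.2 fun F hFu hFv => hcon F hFu.1 hFu.2 hFv.2
  have h1 := hpol.dim_le_encard_facets_mem hu
  have h2 := hpol.dim_le_encard_facets_mem hv
  have h3 : {F | IsFacet P F ∧ u ∈ F} ∪ {F | IsFacet P F ∧ v ∈ F} ⊆ {F | IsFacet P F} :=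
    Set.union_subset (fun F hF => hF.1) fun F hF => hF.1
  have h4 := Set.encard_le_encard h3
  rw [Set.encard_union_eq hdisj, hcard] at h4
  rw [hd] at h1 h2
  have h5 : ((d + d : ℕ) : ℕ∞) ≤ n := by
    push_cast
    exact (add_le_add h1 h2).trans h4
  have : d + d ≤ n := by exact_mod_cast h5
  omega

/-- The facets of `F` are traces of facets of `P` other than `F`, so passing to `F` does not raise
the excess; the vertex `x` bounds their number from below. -/
theorem IsPolytopeWithFacets.exists_of_isFacet (hP : IsPolytopeWithFacets d n P)
    (hF : IsFacet P F) (hx : IsVertex F x) :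
    ∃ n', n' + 1 ≤ n ∧ d ≤ n' + 1 ∧ IsPolytopeWithFacets (d - 1) n' F := by
  obtain ⟨hpol, hne, hd, hcard⟩ := hP
  have hFP := hF.1.isPolytope hpol
  have hsub : {H | IsFacet F H} ⊆ (fun G => G ∩ F) '' ({G | IsFacet P G} \ {F}) := by
    intro H hH
    obtain ⟨G, hG, hGF, rfl⟩ := hpol.exists_isFacet_inter hF hH
    exact ⟨G, ⟨hG, hGF⟩, rfl⟩
  have hle : {H | IsFacet F H}.encard + 1 ≤ n := by
    rw [← hcard, ← Set.encard_sdiff_singleton_add_one (show F ∈ {G | IsFacet P G} from hF)]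
    exact add_le_add ((Set.encard_le_encard hsub).trans (Set.encard_image_le _ _)) le_rfl
  have hfin : {H | IsFacet F H}.Finite := by
    rw [← Set.encard_lt_top_iff]
    exact lt_of_le_of_lt (le_self_add.trans hle) (ENat.natCast_lt_top n)
  have hdim := hF.2
  have hge := (hFP.dim_le_encard_facets_mem hx).trans
    (Set.encard_le_encard (fun H hH => hH.1 : _ ⊆ {H | IsFacet F H}))
  rw [← hfin.cast_ncard_eq] at hle hge
  have hge' : dim F ≤ {H | IsFacet F H}.ncard := by exact_mod_cast hge
  refine ⟨{H | IsFacet F H}.ncard, by exact_mod_cast hle, by omega, hFP, hF.1.1, by omega,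
    hfin.cast_ncard_eq.symm⟩

theorem IsSimple.of_isFacet (hs : IsSimple P) (hP : IsPolytope P) (hF : IsFacet P F) :
    IsSimple F := by
  intro x hx
  apply le_antisymm _ ((hF.1.isPolytope hP).dim_le_encard_facets_mem hx)
  have hxF := hx.subset rfl
  have hsub : {H | IsFacet F H ∧ x ∈ H} ⊆
      (fun G => G ∩ F) '' ({G | IsFacet P G ∧ x ∈ G} \ {F}) := by
    rintro H ⟨hH, hxH⟩
    obtain ⟨G, hG, hGF, rfl⟩ := hP.exists_isFacet_inter hF hH
    exact ⟨G, ⟨⟨hG, hxH.1⟩, hGF⟩, rfl⟩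
  have hle : {H | IsFacet F H ∧ x ∈ H}.encard + 1 ≤ dim F + 1 := by
    have h1 := hs x (hP.isFace_trans hF.1 hx)
    rw [← hF.2, ← Set.encard_sdiff_singleton_add_one
      (show F ∈ {G | IsFacet P G ∧ x ∈ G} from ⟨hF, hxF⟩)] at h1
    push_cast at h1
    rw [← h1]
    exact add_le_add ((Set.encard_le_encard hsub).trans (Set.encard_image_le _ _)) le_rfl
  exact (ENat.add_le_add_iff_right (by simp)).1 hle

end FacetCounts

end Polytope

namespace Polytope

/-! ### Invariance under linear embeddings -/

section Transport

variable {E E' : Type*} [NormedAddCommGroup E] [NormedSpace ℝ E]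
  [NormedAddCommGroup E'] [NormedSpace ℝ E']
variable {P F G H : Set E} {f : E →L[ℝ] E'} {g : E' →L[ℝ] E}

/-- Functionals are pulled back along `f` and along its left inverse `g`. Surjectivity is not
required, so this covers the inclusion of `E` into `E × ℝ`. -/
theorem isFace_image_iff (hgf : Function.LeftInverse g f) {F' : Set E'} :
    IsFace (f '' P) F' ↔ ∃ F, IsFace P F ∧ F' = f '' F := by
  constructor
  · intro hF
    obtain ⟨l, hl⟩ := hF.2 hF.1
    have heq : F' = f '' {x | x ∈ P ∧ ∀ y ∈ P, l.comp f y ≤ l.comp f x} := by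
      rw [hl]
      ext y
      simp only [Set.mem_ofPred_eq, Set.mem_image]
      constructor
      · rintro ⟨⟨x, hx, rfl⟩, h⟩
        exact ⟨x, ⟨hx, fun z hz => h _ ⟨z, hz, rfl⟩⟩, rfl⟩
      · rintro ⟨x, ⟨hx, h⟩, rfl⟩
        refine ⟨⟨x, hx, rfl⟩, ?_⟩
        rintro _ ⟨z, hz, rfl⟩
        exact h z hz
    exact ⟨_, ⟨Set.image_nonempty.1 (heq ▸ hF.1), fun _ => ⟨l.comp f, rfl⟩⟩, heq⟩
  · rintro ⟨F, hF, rfl⟩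
    obtain ⟨l, hl⟩ := hF.2 hF.1
    refine ⟨hF.1.image f, fun _ => ⟨l.comp g, ?_⟩⟩
    conv_lhs => rw [hl]
    ext y
    simp only [Set.mem_ofPred_eq, Set.mem_image, ContinuousLinearMap.comp_apply]
    constructor
    · rintro ⟨x, ⟨hx, h⟩, rfl⟩
      refine ⟨⟨x, hx, rfl⟩, ?_⟩
      rintro _ ⟨z, hz, rfl⟩
      rw [hgf, hgf]
      exact h z hz
    · rintro ⟨⟨x, hx, rfl⟩, h⟩
      exact ⟨x, ⟨hx, fun z hz => by simpa only [hgf _] using h _ ⟨z, hz, rfl⟩⟩, rfl⟩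

theorem dim_image (hf : Function.Injective f) (S : Set E) : dim (f '' S) = dim S := by
  have : (affineSpan ℝ (f '' S)).direction = (affineSpan ℝ S).direction.map (f : E →ₗ[ℝ] E') := by
    simp only [direction_affineSpan, vectorSpan_def, Submodule.map_span]
    congr 1
    ext v
    constructor
    · rintro ⟨_, ⟨x, hx, rfl⟩, _, ⟨y, hy, rfl⟩, rfl⟩
      exact ⟨x - y, ⟨x, hx, y, hy, rfl⟩, by simp⟩
    · rintro ⟨_, ⟨x, hx, y, hy, rfl⟩, rfl⟩
      exact ⟨f x, ⟨x, hx, rfl⟩, f y, ⟨y, hy, rfl⟩, by simp⟩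
  rw [dim, dim, this]
  exact (Submodule.equivMapOfInjective (f : E →ₗ[ℝ] E') hf _).finrank_eq.symm

theorem isFacet_image_iff (hgf : Function.LeftInverse g f) {F' : Set E'} :
    IsFacet (f '' P) F' ↔ ∃ F, IsFacet P F ∧ F' = f '' F := by
  constructor
  · rintro ⟨hF, hd⟩
    obtain ⟨F, hF', rfl⟩ := (isFace_image_iff hgf).1 hF
    rw [dim_image hgf.injective, dim_image hgf.injective] at hd
    exact ⟨F, ⟨hF', hd⟩, rfl⟩
  · rintro ⟨F, hF, rfl⟩
    refine ⟨(isFace_image_iff hgf).2 ⟨F, hF.1, rfl⟩, ?_⟩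
    rw [dim_image hgf.injective, dim_image hgf.injective, hF.2]

theorem isVertex_image_iff (hgf : Function.LeftInverse g f) {y : E'} :
    IsVertex (f '' P) y ↔ ∃ x, IsVertex P x ∧ y = f x := by
  rw [IsVertex, isFace_image_iff hgf]
  constructor
  · rintro ⟨F, hF, hy⟩
    have hyF : y ∈ f '' F := hy ▸ rfl
    obtain ⟨x, hx, rfl⟩ := hyF
    refine ⟨x, ?_, rfl⟩
    rw [← Set.image_singleton, hgf.injective.image_injective.eq_iff] at hy
    rwa [IsVertex, hy]
  · rintro ⟨x, hx, rfl⟩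
    exact ⟨{x}, hx, by simp⟩

theorem NonRevisitingProperty.of_image (hgf : Function.LeftInverse g f)
    (h : NonRevisitingProperty (f '' P)) : NonRevisitingProperty P := by
  rw [nonRevisitingProperty_iff] at h ⊢
  intro u v hu hv
  obtain ⟨n, c, hc0, hcn, hc⟩ := h (f u) (f v) ((isVertex_image_iff hgf).2 ⟨u, hu, rfl⟩)
    ((isVertex_image_iff hgf).2 ⟨v, hv, rfl⟩)
  have hfg : ∀ i ≤ n, f (g (c i)) = c i := fun i hi => by
    obtain ⟨x, -, hx⟩ := (isVertex_image_iff hgf).1 (hc.isVertex i hi)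
    rw [hx, hgf]
  refine ⟨n, fun i => g (c i), by simp only [hc0, hgf u], by simp only [hcn, hgf v],
    fun i hi => ?_, fun i hi => ?_, fun i hi j hj hij => ?_, fun F hF i j l hij hjl hl hi hl' => ?_⟩
  · obtain ⟨x, hxv, hx⟩ := (isVertex_image_iff hgf).1 (hc.isVertex i hi)
    simpa only [hx, hgf x]
  · obtain ⟨e, he, hei, hei'⟩ := hc.exists_edge i hi
    obtain ⟨e, he', rfl⟩ := (isFace_image_iff hgf).1 he.1
    have hd := he.2
    rw [dim_image hgf.injective] at hd
    refine ⟨e, ⟨he', hd⟩, ?_, ?_⟩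
    · rwa [← hfg i hi.le, hgf.injective.mem_set_image] at hei
    · rwa [← hfg (i + 1) hi, hgf.injective.mem_set_image] at hei'
  · apply hc.injOn hi hj
    rw [← hfg i hi, ← hfg j hj]
    exact congrArg f hij
  · have := hc.mem_facet _ ((isFacet_image_iff hgf).2 ⟨F, hF, rfl⟩) i j l hij hjl hl
      (hfg i (by omega) ▸ Set.mem_image_of_mem f hi) (hfg l hl ▸ Set.mem_image_of_mem f hl')
    rwa [← hfg j (by omega), hgf.injective.mem_set_image] at this

theorem encard_facets_image (hgf : Function.LeftInverse g f) :
    {F | IsFacet (f '' P) F}.encard = {F | IsFacet P F}.encard := by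
  rw [← hgf.injective.image_injective.encard_image]
  congr 1
  ext F
  simp only [Set.mem_ofPred_eq, isFacet_image_iff hgf, Set.mem_image, eq_comm]

theorem IsSimple.image (h : IsSimple P) (hgf : Function.LeftInverse g f) :
    IsSimple (f '' P) := by
  intro y hy
  obtain ⟨x, hx, rfl⟩ := (isVertex_image_iff hgf).1 hy
  rw [dim_image hgf.injective, ← h x hx, ← hgf.injective.image_injective.encard_image]
  congr 1
  ext F
  simp only [Set.mem_ofPred_eq, isFacet_image_iff hgf, Set.mem_image]
  constructor
  · rintro ⟨⟨F, hF, rfl⟩, hxF⟩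
    exact ⟨F, ⟨hF, (hgf.injective.mem_set_image).1 hxF⟩, rfl⟩
  · rintro ⟨F, ⟨hF, hxF⟩, rfl⟩
    exact ⟨⟨F, hF, rfl⟩, Set.mem_image_of_mem f hxF⟩

theorem IsPolytope.image_equiv (hP : IsPolytope P) (e : E ≃L[ℝ] E') :
    IsPolytope ((e : E →L[ℝ] E') '' P) := by
  obtain ⟨hbd, m, a, b, hab⟩ := hP
  refine ⟨(e : E →L[ℝ] E').lipschitz.isBounded_image hbd, m,
    fun i => (a i).comp (e.symm : E' →L[ℝ] E), b, ?_⟩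
  ext y
  constructor
  · rintro ⟨x, hx, rfl⟩ i
    rw [hab] at hx
    simpa using hx i
  · intro hy
    refine ⟨e.symm y, ?_, by simp⟩
    rw [hab]
    exact hy

theorem IsPolytopeWithFacets.image_equiv {d n : ℕ} (hP : IsPolytopeWithFacets d n P)
    (e : E ≃L[ℝ] E') : IsPolytopeWithFacets d n ((e : E →L[ℝ] E') '' P) := by
  have hgf : Function.LeftInverse (e.symm : E' →L[ℝ] E) (e : E →L[ℝ] E') := e.symm_apply_apply
  exact ⟨hP.1.image_equiv e, hP.2.1.image _, (dim_image hgf.injective P).trans hP.2.2.1,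
    (encard_facets_image hgf).trans hP.2.2.2⟩

end Transport

end Polytope

namespace Polytope

/-! ### Wedges and prisms -/

section Lift

variable {E : Type*} [NormedAddCommGroup E] [NormedSpace ℝ E]
variable {ι : Type*} {P : Set E} {p x : E} {L : Submodule ℝ E}
  {a : ι → StrongDual ℝ E} {b : ι → ℝ} {k : ι}

/-- The points of `P × ℝ` between the base `P × {0}` and the graph of `c - l`. This is the wedge
over the facet cut out by `l x = c`, or a prism if `l = 0`. -/
def lift (P : Set E) (l : StrongDual ℝ E) (c : ℝ) : Set (E × ℝ) :=
  {y | y.1 ∈ P ∧ 0 ≤ y.2 ∧ l y.1 + y.2 ≤ c}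

/-- The functionals presenting `lift P (a k) (b k)`. -/
def liftFunctional [DecidableEq ι] (a : ι → StrongDual ℝ E) (k : ι) :
    Option ι → StrongDual ℝ (E × ℝ)
  | none => -ContinuousLinearMap.snd ℝ E ℝ
  | some i => (a i).comp (ContinuousLinearMap.fst ℝ E ℝ) +
      if i = k then ContinuousLinearMap.snd ℝ E ℝ else 0

/-- The bounds presenting `lift P (a k) (b k)`. -/
def liftBound (b : ι → ℝ) : Option ι → ℝ
  | none => 0
  | some i => b i

@[simp] theorem liftBound_none : liftBound b none = 0 := rfl

@[simp] theorem liftBound_some (i : ι) : liftBound b (some i) = b i := rfl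

section

variable [DecidableEq ι]

@[simp] theorem liftFunctional_none (y : E × ℝ) : liftFunctional a k none y = -y.2 := rfl

theorem liftFunctional_some_self (y : E × ℝ) :
    liftFunctional a k (some k) y = a k y.1 + y.2 := by simp [liftFunctional]

theorem liftFunctional_some_of_ne {i : ι} (hi : i ≠ k) (y : E × ℝ) :
    liftFunctional a k (some i) y = a i y.1 := by simp [liftFunctional, hi]

end

theorem IsPolytope.lift (hP : IsPolytope P) (l : StrongDual ℝ E) (c : ℝ) :
    IsPolytope (lift P l c) := by
  obtain ⟨hbd, m, a, b, hab⟩ := hP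
  constructor
  · obtain ⟨M, hM⟩ := (l.lipschitz.isBounded_image hbd).bddBelow
    refine (hbd.prod (Metric.isBounded_Icc (0 : ℝ) (c - M))).subset ?_
    rintro ⟨x, t⟩ ⟨hx, ht, hxt⟩
    have := hM (Set.mem_image_of_mem l hx)
    exact ⟨hx, ht, by dsimp only at hxt ⊢; linarith⟩
  · refine ⟨m + 2, Fin.cons (-ContinuousLinearMap.snd ℝ E ℝ) (Fin.cons
      (l.comp (ContinuousLinearMap.fst ℝ E ℝ) + ContinuousLinearMap.snd ℝ E ℝ)
      fun i => (a i).comp (ContinuousLinearMap.fst ℝ E ℝ)), Fin.cons 0 (Fin.cons c b), ?_⟩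
    ext ⟨x, t⟩
    simp only [Polytope.lift, hab, Set.mem_ofPred_eq, Fin.forall_fin_succ, Fin.cons_zero,
      Fin.cons_succ]
    simp
    tauto

theorem wall_lift_none [DecidableEq ι] (hle : ∀ x ∈ P, a k x ≤ b k) :
    wall (lift P (a k) (b k)) (liftFunctional a k) (liftBound b) none =
      ContinuousLinearMap.inl ℝ E ℝ '' P := by
  ext ⟨x, t⟩
  constructor
  · rintro ⟨⟨hx, -⟩, ht⟩
    exact ⟨x, hx, by simpa [eq_comm] using ht⟩
  · rintro ⟨x, hx, h⟩
    obtain ⟨rfl, rfl⟩ := Prod.ext_iff.1 h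
    exact ⟨⟨hx, le_rfl, by simpa using hle x hx⟩, by simp⟩

namespace IsPresentation

variable [DecidableEq ι]

theorem lift (h : IsPresentation P p L a b) (k : ι) :
    IsPresentation (lift P (a k) (b k)) (p, (b k - a k p) / 2)
      (L.comap (LinearMap.fst ℝ E ℝ)) (liftFunctional a k) (liftBound b) where
  mem_iff := by
    rintro ⟨x, t⟩
    simp only [Polytope.lift, Set.mem_ofPred_eq, h.mem_iff, Option.forall, liftFunctional_none,
      liftBound_none, liftBound_some, Submodule.mem_comap, LinearMap.fst_apply, Prod.fst_sub]
    constructor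
    · rintro ⟨⟨hx, hxi⟩, ht, hxt⟩
      refine ⟨hx, by linarith, fun i => ?_⟩
      rcases eq_or_ne i k with rfl | hi
      · rwa [liftFunctional_some_self]
      · rw [liftFunctional_some_of_ne hi]
        exact hxi i
    · rintro ⟨hx, ht, hxi⟩
      have hk := hxi k
      rw [liftFunctional_some_self] at hk
      dsimp only at hk
      refine ⟨⟨hx, fun i => ?_⟩, by linarith, hk⟩
      rcases eq_or_ne i k with rfl | hi
      · linarith
      · have := hxi i
        rwa [liftFunctional_some_of_ne hi] at this
  lt := by
    have hk := h.lt k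
    rintro (_ | i)
    · simpa using hk
    · rcases eq_or_ne i k with rfl | hi
      · rw [liftFunctional_some_self, liftBound_some]
        dsimp only
        linarith
      · rw [liftFunctional_some_of_ne hi]
        exact h.lt i

/-- The `k`-th inequality may be redundant for `P`: the top of the lift is witnessed above the
interior point `p`. This is what lets prisms be treated along with wedges. -/
theorem isIrredundantAt_lift (h : IsPresentation P p L a b)
    (hirr : ∀ i, i ≠ k → IsIrredundantAt P a b i) (j : Option ι) :
    IsIrredundantAt (Polytope.lift P (a k) (b k)) (liftFunctional a k) (liftBound b) j := by
  have hk := h.lt k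
  rcases j with _ | i
  · refine ⟨(p, 0), ⟨h.base_mem, le_rfl, by simpa using hk.le⟩, by simp, ?_⟩
    rintro (_ | i) hi
    · exact absurd rfl hi
    · rcases eq_or_ne i k with rfl | hi
      · simpa [liftFunctional_some_self] using hk
      · simpa [liftFunctional_some_of_ne hi] using h.lt i
  · rcases eq_or_ne i k with rfl | hi
    · refine ⟨(p, b i - a i p), ⟨h.base_mem, by simpa using hk.le, by simp⟩,
        by simp [liftFunctional_some_self], ?_⟩
      rintro (_ | j) hj
      · simpa using hk
      · have hji : j ≠ i := fun heq => hj (by rw [heq])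
        simpa [liftFunctional_some_of_ne hji] using h.lt j
    · obtain ⟨z, hz, hzi, hzj⟩ := hirr i hi
      have hzk := hzj k hi.symm
      refine ⟨(z, (b k - a k z) / 2), ⟨hz, by dsimp only; linarith, by dsimp only; linarith⟩,
        by simpa [liftFunctional_some_of_ne hi] using hzi, ?_⟩
      rintro (_ | j) hj
      · simpa using hzk
      · rcases eq_or_ne j k with rfl | hjk
        · rw [liftFunctional_some_self, liftBound_some]
          dsimp only
          linarith
        · rw [liftFunctional_some_of_ne hjk]
          exact hzj j fun heq => hj (by rw [heq])

variable [FiniteDimensional ℝ E] [Finite ι]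

/-- Each vertex of the lift lies above a vertex of `P` and on one more bounding hyperplane. -/
theorem isVertex_lift (h : IsPresentation P p L a b) {y : E × ℝ}
    (hy : IsVertex (Polytope.lift P (a k) (b k)) y) :
    IsVertex P y.1 ∧ {j | liftFunctional a k j y = liftBound b j}.ncard =
      {i | a i y.1 = b i}.ncard + 1 := by
  obtain ⟨⟨hx, ht, hxt⟩, hy⟩ := (h.lift k).isVertex_iff.1 hy
  obtain ⟨x, t⟩ := y
  simp only [Submodule.mem_comap, LinearMap.fst_apply, Option.forall, liftFunctional_none,
    liftBound_none, liftBound_some, neg_eq_zero] at hy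
  dsimp only at hx ht hxt ⊢
  have himage : (some '' {i | a i x = b i} : Set (Option ι)).ncard = {i | a i x = b i}.ncard :=
    Set.ncard_image_of_injective _ (Option.some_injective ι)
  rw [h.isVertex_iff, ← himage]
  -- On the base the additional tight inequality is `none`; off the base it is `some k`.
  by_cases ht0 : t = 0
  · subst ht0
    refine ⟨⟨hx, fun v hv hv0 => ?_⟩, ?_⟩
    · refine congrArg Prod.fst (hy (v, 0) hv ⟨fun _ => rfl, fun i hi => ?_⟩)
      rcases eq_or_ne i k with rfl | hik
      · rw [liftFunctional_some_self] at hi ⊢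
        simpa using hv0 i (by simpa using hi)
      · rw [liftFunctional_some_of_ne hik] at hi ⊢
        exact hv0 i hi
    · rw [← Set.ncard_insert_of_notMem (a := none) (by simp)]
      congr 1
      ext (_ | i)
      · simp
      · rcases eq_or_ne i k with rfl | hik
        · simp [liftFunctional_some_self]
        · simp [liftFunctional_some_of_ne hik]
  -- Strictly between base and top, the vertical direction `(0, 1)` would be annihilated by all
  -- tight functionals.
  · have htk : a k x + t = b k := by
      by_contra hne
      refine one_ne_zero (congrArg Prod.snd (hy (0, 1) (by simp) ⟨fun h0 => absurd h0 ht0,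
        fun i hi => ?_⟩))
      rcases eq_or_ne i k with rfl | hik
      · rw [liftFunctional_some_self] at hi
        exact absurd hi hne
      · rw [liftFunctional_some_of_ne hik]
        simp
    have hk : a k x ≠ b k := fun hk => ht0 (by linarith)
    refine ⟨⟨hx, fun v hv hv0 => ?_⟩, ?_⟩
    -- The second coordinate makes the lifted direction parallel to the top.
    · refine congrArg Prod.fst (hy (v, -a k v) hv ⟨fun h0 => absurd h0 ht0, fun i hi => ?_⟩)
      rcases eq_or_ne i k with rfl | hik
      · rw [liftFunctional_some_self]
        simp
      · rw [liftFunctional_some_of_ne hik] at hi ⊢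
        exact hv0 i hi
    · rw [← Set.ncard_insert_of_notMem (a := some k) (by simpa using hk)]
      congr 1
      ext (_ | i)
      · simp [ht0]
      · rcases eq_or_ne i k with rfl | hik
        · simp [liftFunctional_some_self, htk]
        · simp [liftFunctional_some_of_ne hik, hik]

/-- The lift is a polytope with one more dimension and one more facet, having `P` as a facet. -/
theorem lift_spec (h : IsPresentation P p L a b) (hP : IsPolytope P)
    (hirr : ∀ i, i ≠ k → IsIrredundantAt P a b i) :
    IsPolytopeWithFacets (dim P + 1) (Nat.card ι + 1) (Polytope.lift P (a k) (b k)) ∧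
      IsFacet (Polytope.lift P (a k) (b k)) (ContinuousLinearMap.inl ℝ E ℝ '' P) ∧
      ((∀ x, IsVertex P x → {i | a i x = b i}.ncard = dim P) →
        IsSimple (Polytope.lift P (a k) (b k))) := by
  have hW := hP.lift (a k) (b k)
  have hpres := h.lift k
  have hirr' := h.isIrredundantAt_lift hirr
  have hfacet := hpres.isFacet_wall (hirr' none)
  rw [wall_lift_none fun x hx => h.le hx k] at hfacet
  have hdim := hfacet.2
  rw [dim_image (LinearMap.inl_injective (R := ℝ) (M := E) (M₂ := ℝ))] at hdim
  refine ⟨⟨hW, ⟨_, hpres.base_mem⟩, hdim.symm, ?_⟩, hfacet, fun hs y hy => ?_⟩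
  · rw [hpres.encard_facets hW hirr', Finite.card_option]
  · obtain ⟨hx, hcard⟩ := h.isVertex_lift hy
    rw [hpres.encard_facets_mem hW hirr' (hy.subset rfl), hcard, hs _ hx, hdim]

end IsPresentation

theorem inl_leftInverse : Function.LeftInverse (ContinuousLinearMap.fst ℝ E ℝ)
    (ContinuousLinearMap.inl ℝ E ℝ) := fun _ => rfl

variable [FiniteDimensional ℝ E] {d n : ℕ}

theorem IsSimple.ncard_eq [Finite ι] (hs : IsSimple P) (h : IsPresentation P p L a b)
    (hP : IsPolytope P) (hirr : ∀ i, IsIrredundantAt P a b i) (hx : IsVertex P x) :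
    {i | a i x = b i}.ncard = dim P := by
  have := hs x hx
  rw [h.encard_facets_mem hP hirr (hx.subset rfl)] at this
  exact_mod_cast this

/-- Every polytope with at least one facet is (up to isomorphism) a facet of its wedge. -/
theorem IsPolytopeWithFacets.exists_wedge (hP : IsPolytopeWithFacets d n P) (hn : n ≠ 0) :
    ∃ W : Set (E × ℝ), IsPolytopeWithFacets (d + 1) (n + 1) W ∧
      IsFacet W (ContinuousLinearMap.inl ℝ E ℝ '' P) ∧ (IsSimple P → IsSimple W) := by
  obtain ⟨hpol, hne, rfl, hcard⟩ := hP
  obtain ⟨m, s, p, L, a, b, h, hirr⟩ := hpol.exists_presentation hne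
  rw [h.encard_facets hpol hirr, Nat.cast_inj] at hcard
  subst hcard
  obtain ⟨k⟩ := (Nat.card_ne_zero.1 hn).1
  obtain ⟨h1, h2, h3⟩ := h.lift_spec (k := k) hpol fun i _ => hirr i
  exact ⟨_, h1, h2, fun hs => h3 fun x hx => hs.ncard_eq h hpol hirr hx⟩

/-- Every polytope is (up to isomorphism) a facet of the prism over it, which is its lift over a
redundant inequality. -/
theorem IsPolytopeWithFacets.exists_prism (hP : IsPolytopeWithFacets d n P) :
    ∃ W : Set (E × ℝ), IsPolytopeWithFacets (d + 1) (n + 2) W ∧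
      IsFacet W (ContinuousLinearMap.inl ℝ E ℝ '' P) ∧ (IsSimple P → IsSimple W) := by
  obtain ⟨hpol, hne, rfl, hcard⟩ := hP
  obtain ⟨m, s, p, L, a, b, h, hirr⟩ := hpol.exists_presentation hne
  rw [h.encard_facets hpol hirr, Nat.cast_inj] at hcard
  subst hcard
  -- The added inequality is `0 ≤ 1`, so the top of the lift is a copy of `P` at height `1`.
  let a' : Option s → StrongDual ℝ E := fun j => j.elim 0 a
  let b' : Option s → ℝ := fun j => j.elim 1 b
  have h' : IsPresentation P p L a' b' := by
    refine ⟨fun x => ?_, ?_⟩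
    · rw [h.mem_iff]
      simp [Option.forall, a', b']
    · rintro (_ | i)
      · simp [a', b']
      · exact h.lt i
  have hirr' : ∀ j, j ≠ none → IsIrredundantAt P a' b' j := by
    rintro (_ | i) hj
    · exact absurd rfl hj
    · obtain ⟨z, hz, hzi, hzj⟩ := hirr i
      refine ⟨z, hz, hzi, ?_⟩
      rintro (_ | j) hj
      · simp [a', b']
      · exact hzj j fun heq => hj (by rw [heq])
  obtain ⟨h1, h2, h3⟩ := h'.lift_spec hpol hirr'
  rw [Finite.card_option] at h1
  refine ⟨_, h1, h2, fun hs => h3 fun x hx => ?_⟩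
  rw [← hs.ncard_eq h hpol hirr hx, ← Set.ncard_image_of_injective _ (Option.some_injective s)]
  congr 1
  ext (_ | i)
  · simp [a', b']
  · simp [a', b']

end Lift

end Polytope

namespace Polytope

/-! ### Induction on dimension and excess -/

section Reduction

/-- All `d`-polytopes with `d + k` facets have the non-revisiting property (if `s` holds, only
the simple ones are considered). -/
def AllNonRevisiting (s : Prop) (d k : ℕ) : Prop :=
  ∀ (E : Type) [NormedAddCommGroup E] [NormedSpace ℝ E] [FiniteDimensional ℝ E] (P : Set E),
    IsPolytopeWithFacets d (d + k) P → (s → IsSimple P) → NonRevisitingProperty P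

variable {s : Prop} {d k : ℕ}

/-- Lifts live in `E × ℝ`, so the induction runs over all finite-dimensional spaces. -/
theorem AllNonRevisiting.of_euclideanSpace
    (h : ∀ (N : ℕ) (P : Set (EuclideanSpace ℝ (Fin N))),
      IsPolytopeWithFacets d (d + k) P → (s → IsSimple P) → NonRevisitingProperty P) :
    AllNonRevisiting s d k := by
  intro E _ _ _ P hP hs
  let e : E ≃L[ℝ] EuclideanSpace ℝ (Fin (Module.finrank ℝ E)) := toEuclidean
  have hgf : Function.LeftInverse
      (e.symm : EuclideanSpace ℝ (Fin (Module.finrank ℝ E)) →L[ℝ] E)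
      (e : E →L[ℝ] EuclideanSpace ℝ (Fin (Module.finrank ℝ E))) := e.symm_apply_apply
  exact (h _ _ (hP.image_equiv e) fun h' => (hs h').image hgf).of_image hgf

theorem AllNonRevisiting.of_prism (h : AllNonRevisiting s (d + 1) (k + 1)) :
    AllNonRevisiting s d k := by
  intro E _ _ _ P hP hs
  obtain ⟨W, hW, hPW, hsW⟩ := hP.exists_prism
  have hW' : IsPolytopeWithFacets (d + 1) (d + 1 + (k + 1)) W := by
    convert hW using 1
    omega
  exact ((h _ W hW' fun h' => hsW (hs h')).of_isFacet hW.1 hPW).of_image inl_leftInverse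

theorem AllNonRevisiting.of_wedge (h : AllNonRevisiting s (d + 1) k) (hdk : d + k ≠ 0) :
    AllNonRevisiting s d k := by
  intro E _ _ _ P hP hs
  obtain ⟨W, hW, hPW, hsW⟩ := hP.exists_wedge hdk
  have hW' : IsPolytopeWithFacets (d + 1) (d + 1 + k) W := by
    convert hW using 1
    omega
  exact ((h _ W hW' fun h' => hsW (hs h')).of_isFacet hW.1 hPW).of_image inl_leftInverse

/-- Two vertices share a facet, and a path is taken inside it. The excess of that facet may be any
`k' ≤ k`, hence the form of the hypothesis. -/
theorem AllNonRevisiting.succ_of_le (h : ∀ k' ≤ k, AllNonRevisiting s d k') (hkd : k ≤ d) :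
    AllNonRevisiting s (d + 1) k := by
  intro E _ _ _ P hP hs
  rw [nonRevisitingProperty_iff]
  intro u v hu hv
  obtain ⟨F, hF, huF, hvF⟩ := exists_isFacet_of_lt_two_mul hP (by omega) hu hv
  have hu' := hu.of_subset hF.1 (Set.singleton_subset_iff.2 huF)
  have hv' := hv.of_subset hF.1 (Set.singleton_subset_iff.2 hvF)
  obtain ⟨n, hn, hdn, hFn⟩ := hP.exists_of_isFacet hF hu'
  obtain ⟨k', rfl⟩ : ∃ k', n = d + k' := ⟨n - d, by omega⟩
  have hNR := h k' (by omega) E F hFn fun h' => (hs h').of_isFacet hP.1 hF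
  obtain ⟨n, f, hf0, hfn, hf⟩ := nonRevisitingProperty_iff.1 hNR u v hu' hv'
  exact ⟨n, f, hf0, hfn, hf.of_isFacet hP.1 hF⟩

theorem AllNonRevisiting.all (h : AllNonRevisiting s k k) (d : ℕ) : AllNonRevisiting s d k := by
  have hdiag : ∀ m ≤ k, AllNonRevisiting s m m := fun m hm =>
    Nat.decreasingInduction (motive := fun m _ => AllNonRevisiting s m m)
      (fun _ _ ih => ih.of_prism) h hm
  have hge : ∀ d, ∀ m ≤ k, m ≤ d → AllNonRevisiting s d m := by
    intro d
    induction d with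
    | zero =>
      intro m hm hmd
      obtain rfl := Nat.le_zero.1 hmd
      exact hdiag 0 hm
    | succ d ih =>
      intro m hm hmd
      rcases hmd.eq_or_lt with rfl | hlt
      · exact hdiag _ hm
      · exact .succ_of_le (fun k' hk' => ih k' (by omega) (by omega)) (by omega)
  rcases le_total k d with hkd | hdk
  · exact hge d k le_rfl hkd
  -- Here `d < k`, so `d + k ≠ 0` and there is a facet over which to form the wedge.
  · exact Nat.decreasingInduction (motive := fun d _ => AllNonRevisiting s d k)
      (fun d hd ih => ih.of_wedge (by omega)) h hdk

end Reduction

end Polytope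

theorem theorem3p3 (k : ℕ) :
    ((∀ (N : ℕ) (P : Set (EuclideanSpace ℝ (Fin N))),
        Polytope.IsPolytopeWithFacets k (2 * k) P → Polytope.NonRevisitingProperty P) →
      ∀ (d N : ℕ) (P : Set (EuclideanSpace ℝ (Fin N))),
        Polytope.IsPolytopeWithFacets d (d + k) P → Polytope.NonRevisitingProperty P) ∧
    ((∀ (N : ℕ) (P : Set (EuclideanSpace ℝ (Fin N))),
        Polytope.IsPolytopeWithFacets k (2 * k) P → Polytope.IsSimple P →
          Polytope.NonRevisitingProperty P) →
      ∀ (d N : ℕ) (P : Set (EuclideanSpace ℝ (Fin N))),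
        Polytope.IsPolytopeWithFacets d (d + k) P → Polytope.IsSimple P →
          Polytope.NonRevisitingProperty P) := by
  constructor
  · intro h d N P hP
    -- With `s := False` the simplicity condition is vacuous.
    refine (Polytope.AllNonRevisiting.of_euclideanSpace (s := False) fun N P hP _ => ?_).all d
      (k := k) _ P hP False.elim
    exact h N P (by rwa [two_mul])
  · intro h d N P hP hs
    refine (Polytope.AllNonRevisiting.of_euclideanSpace (s := True) fun N P hP hs => ?_).all d
      (k := k) _ P hP fun _ => hs
    exact h N P (by rwa [two_mul]) (hs trivial)
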